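/- For $A\subseteq\mathbb N=\{1,2,3,\dots\}$ say that $A$ has density $d(A)=\delta$ if $\lim_{N\to\infty}\frac1N|A\cap\{1,\dots,N\}|=\delta$, and let $\underline d(A)=\liminf_{N\to\infty}\frac1N|A\cap\{1,\dots,N\}|$ be its lower density. Write $A+h=\{a+h: a\in A\}$. A set $S\subseteq\mathbb N$ is called stable if for every prime $p$ the set $\{n\in\mathbb N:\ \mathbf 1_{n\in S}\neq\mathbf 1_{pn\in S}\}$ has density $0$. **Theorem.** There is a stable set $S\subseteq\mathbb N$ with $d(S)=\frac12$ such that, with $I=S\cap(S+1)\cap(S+2)$, one has $d(I)=0$. Moreover $S'=S\setminus I$ is a stable set with $d(S')=\frac12$ and $$S'\cap(S'+1)\cap(S'+2)=\emptyset .$$ In particular, the following assertion (the weak form of Hildebrand's conjecture for $k$ consecutive shifts) is false for $k=3$: for every stable set $S\subseteq\mathbb N$ with $\underline d(S)>0$, the set $S\cap(S+1)\cap\cdots\cap(S+(k-1))$ is nonempty. -/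

import Mathlib

open Filter Topology

/-- The proportion of elements of `S` among `1, …, N` (the value at `N = 0` is irrelevant). -/
noncomputable def countRatio (S : Set ℕ) (N : ℕ) : ℝ :=
  ((S ∩ Set.Icc 1 N).ncard : ℝ) / (N : ℝ)

/-- `S` has natural (asymptotic) density `δ`: the limit exists and equals `δ`. -/
def HasDensity (S : Set ℕ) (δ : ℝ) : Prop :=
  Tendsto (countRatio S) atTop (𝓝 δ)

/-- The lower asymptotic density of `S`. -/
noncomputable def lowerDensity (S : Set ℕ) : ℝ :=
  liminf (countRatio S) atTop

/-- `S` is stable: for every prime `p`, one has `n ∈ S ↔ p * n ∈ S` for all `n` outside a set of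
density zero. -/
def IsStable (S : Set ℕ) : Prop :=
  ∀ p : ℕ, p.Prime → HasDensity {n : ℕ | ¬ (n ∈ S ↔ p * n ∈ S)} 0

/-- `S ∩ (S + 1) ∩ ⋯ ∩ (S + (k - 1))`, where `S + j = {s + j : s ∈ S}`. -/
def shiftInter (S : Set ℕ) (k : ℕ) : Set ℕ :=
  ⋂ j ∈ Set.Iio k, (fun s : ℕ => s + j) '' S

/-- The weak form of Hildebrand's conjecture for a given `k`: for every stable set `S` of positive
integers with positive lower density, `S ∩ (S + 1) ∩ ⋯ ∩ (S + (k - 1))` is nonempty. -/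
def WeakHildebrandConjecture (k : ℕ) : Prop :=
  ∀ S : Set ℕ, 0 ∉ S → IsStable S → 0 < lowerDensity S → (shiftInter S k).Nonempty

/-! Let χ be the completely multiplicative sign with χ(3) = 1 that agrees with the nontrivial
character modulo 3 off the multiples of 3. By Kronecker's theorem some θ puts θ log p near an
integer, even exactly when χ(p) = 1, for all primes p up to a given bound. Take the n with
χ(n)(-1)^⌊θ log n⌋ = 1. Multiplication by such a p changes both signs or neither, except near jumps
of the floor, so the set is nearly stable. The second sign is almost always locally constant, so
neighbours in the classes 1 and 2 modulo 3 are separated; any three consecutive integers contain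
such a pair.

A single θ handles finitely many primes, with a positive error. One therefore passes from each θ to
a better one through intermediate sets that differ little in density (`exists_slowly_varying_seq`)
and glues the sequence along rapidly growing breakpoints (`exists_glued_set`); the errors tend to 0,
giving `exists_isStable_unseparated`.

Density 1/2 comes from separation and stability at 3: the classes 1 and 2 cancel and multiples of 3
copy S, so the excess up to 3M is nearly that up to M (`excess_le_of_separated`). Deleting the null
set of triples changes neither density nor stability. -/

/-! ### Counting functions and upper density. -/

/-- The number of elements of `A` among `1, …, N`. -/
noncomputable def cnt (A : Set ℕ) (N : ℕ) : ℕ := (A ∩ Set.Icc 1 N).ncard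

/-- The upper density of `A` is at most `ε`, with the bound attained at every large `N`. -/
def UpperDensityLE (A : Set ℕ) (ε : ℝ) : Prop := ∀ᶠ N : ℕ in atTop, (cnt A N : ℝ) ≤ ε * N

theorem finite_inter_Icc (A : Set ℕ) (N : ℕ) : (A ∩ Set.Icc 1 N).Finite :=
  (Set.finite_Icc 1 N).subset Set.inter_subset_right

theorem cnt_le_of_imp {A B : Set ℕ} {N : ℕ} (h : ∀ n, 1 ≤ n → n ≤ N → n ∈ A → n ∈ B) :
    cnt A N ≤ cnt B N :=
  Set.ncard_le_ncard (fun n hn => ⟨h n hn.2.1 hn.2.2 hn.1, hn.2⟩) (finite_inter_Icc B N)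

theorem cnt_mono_right (A : Set ℕ) {M N : ℕ} (h : M ≤ N) : cnt A M ≤ cnt A N :=
  Set.ncard_le_ncard (fun _ hn => ⟨hn.1, hn.2.1, hn.2.2.trans h⟩) (finite_inter_Icc A N)

theorem cnt_union_le (A B : Set ℕ) (N : ℕ) : cnt (A ∪ B) N ≤ cnt A N + cnt B N := by
  unfold cnt
  rw [Set.union_inter_distrib_right]
  exact Set.ncard_union_le _ _

theorem cnt_le (A : Set ℕ) (N : ℕ) : cnt A N ≤ N := by
  calc cnt A N ≤ (Set.Icc 1 N).ncard :=
        Set.ncard_le_ncard Set.inter_subset_right (Set.finite_Icc 1 N)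
    _ = N := by rw [← Finset.coe_Icc, Set.ncard_coe_finset]; simp

theorem cnt_le_of_injective {A B : Set ℕ} {M N : ℕ} (f : ℕ → ℕ) (hf : Function.Injective f)
    (h : ∀ n, 1 ≤ n → n ≤ M → n ∈ A → f n ∈ B ∧ 1 ≤ f n ∧ f n ≤ N) : cnt A M ≤ cnt B N := by
  unfold cnt
  rw [← Set.ncard_image_of_injective _ hf]
  refine Set.ncard_le_ncard ?_ (finite_inter_Icc B N)
  rintro _ ⟨n, hn, rfl⟩
  have := h n hn.2.1 hn.2.2 hn.1
  exact ⟨this.1, this.2⟩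

theorem UpperDensityLE.mono {A B : Set ℕ} {ε δ : ℝ} (hB : UpperDensityLE B ε)
    (h : ∀ᶠ n in atTop, n ∈ A → n ∈ B) (hδ : ε < δ) : UpperDensityLE A δ := by
  obtain ⟨K, hK⟩ := eventually_atTop.1 h
  have h1 : ∀ᶠ N : ℕ in atTop, (K : ℝ) ≤ (δ - ε) * N :=
    (tendsto_natCast_atTop_atTop.const_mul_atTop (sub_pos.2 hδ)).eventually_ge_atTop _
  filter_upwards [hB, h1] with N hN h1
  have h2 : cnt A N ≤ cnt (B ∪ Set.Iic K) N := cnt_le_of_imp fun n _ _ hn => by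
    rcases le_total n K with h | h
    · exact Or.inr h
    · exact Or.inl (hK n h hn)
  have h3 : cnt (Set.Iic K) N ≤ K := by
    calc cnt (Set.Iic K) N ≤ (Set.Icc 1 K).ncard :=
          Set.ncard_le_ncard (fun n hn => ⟨hn.2.1, hn.1⟩) (Set.finite_Icc 1 K)
      _ = K := by rw [← Finset.coe_Icc, Set.ncard_coe_finset]; simp
  have h4 : (cnt A N : ℝ) ≤ cnt B N + K := by
    exact_mod_cast h2.trans ((cnt_union_le _ _ _).trans (by omega))
  linarith

theorem UpperDensityLE.subset {A B : Set ℕ} {ε δ : ℝ} (hB : UpperDensityLE B ε)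
    (h : A ⊆ B) (hδ : ε ≤ δ) : UpperDensityLE A δ := by
  filter_upwards [hB] with N hN
  have h2 : (cnt A N : ℝ) ≤ cnt B N := by exact_mod_cast cnt_le_of_imp fun n _ _ hn => h hn
  have : ε * (N : ℝ) ≤ δ * N := by gcongr
  linarith

theorem UpperDensityLE.union {A B : Set ℕ} {ε δ : ℝ} (hA : UpperDensityLE A ε)
    (hB : UpperDensityLE B δ) : UpperDensityLE (A ∪ B) (ε + δ) := by
  filter_upwards [hA, hB] with N h1 h2
  have : (cnt (A ∪ B) N : ℝ) ≤ cnt A N + cnt B N := by exact_mod_cast cnt_union_le A B N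
  linarith

theorem upperDensityLE_of_one_le (A : Set ℕ) {ε : ℝ} (h : 1 ≤ ε) : UpperDensityLE A ε :=
  Eventually.of_forall fun N => by
    have : (cnt A N : ℝ) ≤ N := by exact_mod_cast cnt_le A N
    nlinarith [(Nat.cast_nonneg N : (0 : ℝ) ≤ N)]

theorem hasDensity_zero_iff {A : Set ℕ} :
    HasDensity A 0 ↔ ∀ ε > 0, UpperDensityLE A ε := by
  unfold HasDensity
  rw [Metric.tendsto_atTop']
  constructor
  · intro h ε hε
    obtain ⟨K, hK⟩ := h ε hε
    filter_upwards [eventually_gt_atTop K] with N hN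
    have := hK N hN
    rw [dist_zero_right, Real.norm_eq_abs] at this
    have h2 := (abs_lt.1 this).2.le
    have h0 : (0 : ℝ) < N := by exact_mod_cast (Nat.zero_le K).trans_lt hN
    unfold countRatio at h2
    rw [div_le_iff₀ h0] at h2
    exact h2
  · intro h ε hε
    obtain ⟨K, hK⟩ := eventually_atTop.1 (h (ε / 2) (half_pos hε))
    refine ⟨K, fun N hN => ?_⟩
    have := hK N hN.le
    have h0 : (0 : ℝ) < N := by exact_mod_cast (Nat.zero_le K).trans_lt hN
    have h3 : countRatio A N ≤ ε / 2 := by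
      unfold countRatio
      rw [div_le_iff₀ h0]
      exact this
    have h4 : 0 ≤ countRatio A N := by unfold countRatio; positivity
    rw [dist_zero_right, Real.norm_eq_abs, abs_of_nonneg h4]
    linarith

/-! ### Equidistribution of lines in a torus and Kronecker's theorem. -/

-- The integral factors over the coordinates, and a nontrivial character of the circle changes sign
-- under a suitable translation.
open MeasureTheory in
theorem integral_mFourier_eq_zero {d : Type*} [Fintype d] {n : d → ℤ} (hn : n ≠ 0) :
    ∫ x, UnitAddTorus.mFourier n x ∂(Measure.pi fun _ : d => (AddCircle.haarAddCircle (T := 1)))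
      = 0 := by
  obtain ⟨i, hi⟩ := Function.ne_iff.1 hn
  simp only [UnitAddTorus.mFourier, ContinuousMap.coe_mk]
  rw [integral_fintype_prod_eq_prod (fun i (x : UnitAddCircle) => (fourier (n i) x : ℂ))]
  refine Finset.prod_eq_zero (Finset.mem_univ i) ?_
  exact integral_eq_zero_of_add_right_eq_neg (fourier_add_half_inv_index hi one_pos)

theorem tendsto_mean_exp_zero {c : ℝ} (hc : c ≠ 0) :
    Tendsto (fun T : ℝ => (T : ℂ)⁻¹ * ∫ t in (0 : ℝ)..T, Complex.exp (Complex.I * c * t))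
      atTop (𝓝 0) := by
  have hc' : Complex.I * (c : ℂ) ≠ 0 := mul_ne_zero Complex.I_ne_zero (by exact_mod_cast hc)
  rw [tendsto_zero_iff_norm_tendsto_zero]
  have h0 : Tendsto (fun T : ℝ => T⁻¹ * (2 / |c|)) atTop (𝓝 0) := by
    simpa using tendsto_inv_atTop_zero.mul_const (2 / |c|)
  refine squeeze_zero' (Eventually.of_forall fun _ => norm_nonneg _) ?_ h0
  filter_upwards [eventually_gt_atTop 0] with T hT
  rw [integral_exp_mul_complex hc', norm_mul, norm_inv, Complex.norm_real, Real.norm_eq_abs,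
    abs_of_pos hT, norm_div, norm_mul, Complex.norm_I, Complex.norm_real, Real.norm_eq_abs, one_mul]
  gcongr
  refine (norm_sub_le _ _).trans ?_
  have h (x : ℝ) : ‖Complex.exp (Complex.I * c * x)‖ = 1 := by
    rw [show Complex.I * c * x = ((c * x : ℝ) : ℂ) * Complex.I by push_cast; ring,
      Complex.norm_exp_ofReal_mul_I]
  rw [h, h]
  norm_num

theorem mFourier_line {d : Type*} [Fintype d] (n : d → ℤ) (a : d → ℝ) (t : ℝ) :
    UnitAddTorus.mFourier n (fun i => ((t * a i : ℝ) : UnitAddCircle)) =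
      Complex.exp (Complex.I * ((2 * Real.pi * ∑ i, n i * a i : ℝ) : ℂ) * t) := by
  simp only [UnitAddTorus.mFourier, ContinuousMap.coe_mk, fourier_coe_apply]
  rw [← Complex.exp_sum]
  congr 1
  push_cast
  rw [Finset.mul_sum, Finset.mul_sum, Finset.sum_mul]
  refine Finset.sum_congr rfl fun i _ => ?_
  ring

open MeasureTheory in
/-- Weyl equidistribution of a line with rationally independent slopes, for trigonometric
polynomials. -/
theorem tendsto_mean_line {d : Type*} [Fintype d] {a : d → ℝ}
    (ha : ∀ n : d → ℤ, ∑ i, n i * a i = 0 → n = 0) {F : C(UnitAddTorus d, ℂ)}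
    (hF : F ∈ Submodule.span ℂ (Set.range (UnitAddTorus.mFourier (d := d)))) :
    Tendsto (fun T : ℝ => (T : ℂ)⁻¹ *
        ∫ t in (0 : ℝ)..T, F (fun i => ((t * a i : ℝ) : UnitAddCircle))) atTop
      (𝓝 (∫ x, F x ∂(Measure.pi fun _ : d => (AddCircle.haarAddCircle (T := 1))))) := by
  have hcont (F : C(UnitAddTorus d, ℂ)) :
      Continuous fun t : ℝ => F (fun i => ((t * a i : ℝ) : UnitAddCircle)) := by
    refine F.continuous.comp (continuous_pi fun i => ?_)
    exact (AddCircle.continuous_mk' 1).comp (by fun_prop)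
  have hint (F : C(UnitAddTorus d, ℂ)) :
      Integrable F (Measure.pi fun _ : d => (AddCircle.haarAddCircle (T := 1))) :=
    F.continuous.integrable_of_hasCompactSupport (HasCompactSupport.of_compactSpace _)
  induction hF using Submodule.span_induction with
  | mem F hF =>
    obtain ⟨n, rfl⟩ := hF
    by_cases hn : n = 0
    · subst hn
      simp only [UnitAddTorus.mFourier_zero, ContinuousMap.one_apply]
      refine Tendsto.congr' ?_ (tendsto_const_nhds (x := (1 : ℂ))) |>.trans (by simp)
      filter_upwards [eventually_gt_atTop 0] with T hT
      have : (T : ℂ) ≠ 0 := by exact_mod_cast hT.ne'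
      simp [this]
    · rw [integral_mFourier_eq_zero hn]
      simp_rw [mFourier_line]
      refine tendsto_mean_exp_zero ?_
      have := mt (ha n) hn
      positivity
  | zero => simp
  | add F G _ _ hF hG =>
    simp only [ContinuousMap.add_apply]
    rw [integral_add (hint F) (hint G)]
    refine (hF.add hG).congr fun T => ?_
    rw [intervalIntegral.integral_add ((hcont F).intervalIntegrable _ _)
      ((hcont G).intervalIntegrable _ _), mul_add]
  | smul c F _ hF =>
    simp only [ContinuousMap.smul_apply, smul_eq_mul]
    rw [integral_const_mul]
    refine (hF.const_mul c).congr fun T => ?_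
    rw [intervalIntegral.integral_const_mul]
    ring

-- Trigonometric polynomials are uniformly dense, and for them the mean along the line tends to the
-- integral.
open MeasureTheory in
theorem integral_eq_zero_of_line_eq_zero {d : Type*} [Fintype d] {a : d → ℝ}
    (ha : ∀ n : d → ℤ, ∑ i, n i * a i = 0 → n = 0) {F : C(UnitAddTorus d, ℂ)}
    (hF : ∀ t : ℝ, F (fun i => ((t * a i : ℝ) : UnitAddCircle)) = 0) :
    ∫ x, F x ∂(Measure.pi fun _ : d => (AddCircle.haarAddCircle (T := 1))) = 0 := by
  have hint (F : C(UnitAddTorus d, ℂ)) :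
      Integrable F (Measure.pi fun _ : d => (AddCircle.haarAddCircle (T := 1))) :=
    F.continuous.integrable_of_hasCompactSupport (HasCompactSupport.of_compactSpace _)
  rw [← norm_eq_zero]
  refine le_antisymm (le_of_forall_pos_le_add fun ε hε => ?_) (norm_nonneg _)
  have hmem : F ∈ (Submodule.span ℂ
      (Set.range (UnitAddTorus.mFourier (d := d)))).topologicalClosure := by
    rw [UnitAddTorus.span_mFourier_closure_eq_top]; trivial
  obtain ⟨P, hP, hFP⟩ := Metric.mem_closure_iff.1 hmem (ε / 2) (half_pos hε)
  rw [dist_eq_norm] at hFP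
  have h1 : ‖∫ x, P x ∂(Measure.pi fun _ : d => (AddCircle.haarAddCircle (T := 1)))‖ ≤ ε / 2 := by
    refine le_of_tendsto (tendsto_mean_line ha hP).norm ?_
    filter_upwards [eventually_gt_atTop 0] with T hT
    have h2 : ‖∫ t in (0 : ℝ)..T, P (fun i => ((t * a i : ℝ) : UnitAddCircle))‖
        ≤ ε / 2 * |T - 0| := by
      refine intervalIntegral.norm_integral_le_of_norm_le_const fun t _ => ?_
      have := ((F - P).norm_coe_le_norm (fun i => ((t * a i : ℝ) : UnitAddCircle))).trans hFP.le
      rwa [ContinuousMap.sub_apply, hF, zero_sub, norm_neg] at this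
    rw [norm_mul, norm_inv, Complex.norm_real, Real.norm_eq_abs]
    rw [sub_zero] at h2
    rw [inv_mul_le_iff₀ (abs_pos.2 hT.ne')]
    linarith
  have h3 : ‖∫ x, (F x - P x) ∂(Measure.pi fun _ : d => (AddCircle.haarAddCircle (T := 1)))‖
      ≤ ε / 2 := by
    refine (norm_integral_le_of_norm_le_const
      (Eventually.of_forall fun x => ((F - P).norm_coe_le_norm x).trans hFP.le)).trans ?_
    simp
  rw [integral_sub (hint F) (hint P)] at h3
  have := norm_sub_norm_le (∫ x, F x ∂(Measure.pi fun _ : d => (AddCircle.haarAddCircle (T := 1))))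
    (∫ x, P x ∂(Measure.pi fun _ : d => (AddCircle.haarAddCircle (T := 1))))
  linarith

open MeasureTheory in
/-- **Kronecker's theorem** for a line in the torus. -/
theorem exists_line_mem {d : Type*} [Fintype d] {a : d → ℝ}
    (ha : ∀ n : d → ℤ, ∑ i, n i * a i = 0 → n = 0) {U : Set (UnitAddTorus d)} (hU : IsOpen U)
    (hne : U.Nonempty) : ∃ t : ℝ, (fun i => ((t * a i : ℝ) : UnitAddCircle)) ∈ U := by
  obtain ⟨x, hx⟩ := hne
  by_contra! hcon
  -- A Urysohn function supported in `U` would vanish along the whole line yet have positive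
  -- integral.
  obtain ⟨f, hf0, hf1, hf⟩ := exists_continuous_zero_one_of_isClosed hU.isClosed_compl
    (isClosed_singleton (x := x)) (by simpa using hx)
  set μ := (Measure.pi fun _ : d => (AddCircle.haarAddCircle (T := 1)))
  let F : C(UnitAddTorus d, ℂ) := ⟨fun y => (f y : ℂ), by fun_prop⟩
  have h0 : ∫ y, F y ∂μ = 0 := integral_eq_zero_of_line_eq_zero ha fun t => by
    have : f (fun i => ((t * a i : ℝ) : UnitAddCircle)) = 0 := hf0 (hcon t)
    simp [F, this]
  have h1 : ∫ y, f y ∂μ = 0 := by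
    have : ∫ y, F y ∂μ = ((∫ y, f y ∂μ : ℝ) : ℂ) := integral_ofReal
    rw [this] at h0
    exact_mod_cast h0
  have h2 : 0 < ∫ y, f y ∂μ :=
    f.continuous.integral_pos_of_hasCompactSupport_nonneg_nonzero
      (HasCompactSupport.of_compactSpace _) (fun y => (hf y).1)
      (x := x) (by rw [hf1 (Set.mem_singleton x)]; simp)
  exact h2.ne' h1

/-! ### Simultaneous approximation by logarithms of primes. -/

/-- Exponentiating turns the relation into a product of prime powers equal to 1; the `j`-adic
valuation isolates `n j`. -/
theorem sum_mul_log_prime_eq_zero {s : Finset ℕ} (hs : ∀ p ∈ s, p.Prime) (n : s → ℤ)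
    (h : ∑ i, (n i : ℝ) * Real.log (i : ℕ) = 0) : n = 0 := by
  have hpos (i : s) : (0 : ℝ) < (i : ℕ) := by exact_mod_cast (hs i i.2).pos
  have h1 : ∏ i : s, ((i : ℕ) : ℝ) ^ n i = 1 := by
    refine Real.log_injOn_pos ?_ (by simp) ?_
    · exact Set.mem_Ioi.2 (Finset.prod_pos fun i _ => zpow_pos (hpos i) _)
    · rw [Real.log_prod fun i _ => (zpow_pos (hpos i) _).ne', Real.log_one, ← h]
      exact Finset.sum_congr rfl fun i _ => Real.log_zpow _ _
  have h2 : ∏ i : s, ((i : ℕ) : ℚ) ^ n i = 1 := by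
    refine Rat.cast_injective (α := ℝ) ?_
    push_cast
    exact h1
  funext j
  have : Fact (j : ℕ).Prime := ⟨hs j j.2⟩
  have h3 := congrArg (padicValRat (j : ℕ)) h2
  have hne (i : s) : ((i : ℕ) : ℚ) ^ n i ≠ 0 :=
    zpow_ne_zero _ (by exact_mod_cast (hs i i.2).ne_zero)
  have h4 (t : Finset s) : padicValRat (j : ℕ) (∏ i ∈ t, ((i : ℕ) : ℚ) ^ n i)
      = ∑ i ∈ t, padicValRat (j : ℕ) (((i : ℕ) : ℚ) ^ n i) := by
    induction t using Finset.cons_induction with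
    | empty => simp
    | cons i t hi ih =>
      rw [Finset.prod_cons, Finset.sum_cons,
        padicValRat.mul (hne i) (Finset.prod_ne_zero_iff.2 fun k _ => hne k), ih]
  rw [h4, padicValRat.one, Finset.sum_eq_single j] at h3
  · rw [padicValRat.zpow, padicValRat.self (hs j j.2).one_lt] at h3
    simpa using h3
  · intro i _ hij
    have : Fact (i : ℕ).Prime := ⟨hs i i.2⟩
    have : padicValNat (j : ℕ) (i : ℕ) = 0 :=
      padicValNat_primes fun h => hij (Subtype.ext h.symm)
    rw [padicValRat.zpow, padicValRat.of_nat, this]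
    simp
  · simp

/-- The logarithms of finitely many primes can be simultaneously dilated to lie near integers of
prescribed parities. -/
theorem exists_mul_log_prime_near (T : Set ℕ) {s : Finset ℕ} (hs : ∀ p ∈ s, p.Prime)
    {ε : ℝ} (hε : 0 < ε) : ∃ θ : ℝ, ∀ p ∈ s, ∃ m : ℤ,
      (Even m ↔ p ∈ T) ∧ |θ * Real.log p - m| ≤ ε := by
  classical
  let a : s → ℝ := fun i => Real.log (i : ℕ)
  -- The parameter is doubled at the end: phase 0 then gives an even integer and phase 1/2 an odd
  -- one, and the radius ε/2 becomes ε.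
  let b : s → ℝ := fun i => if (i : ℕ) ∈ T then 0 else 1 / 2
  let U : Set (UnitAddTorus s) :=
    Set.pi Set.univ fun i => Metric.ball ((b i : ℝ) : UnitAddCircle) (ε / 2)
  have hU : IsOpen U := isOpen_set_pi Set.finite_univ fun i _ => Metric.isOpen_ball
  obtain ⟨t, ht⟩ := exists_line_mem (a := a) (fun n hn => sum_mul_log_prime_eq_zero hs n hn) hU
    ⟨fun i => b i, fun i _ => Metric.mem_ball_self (half_pos hε)⟩
  refine ⟨2 * t, fun p hp => ?_⟩
  have h := ht ⟨p, hp⟩ (Set.mem_univ _)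
  rw [Metric.mem_ball, dist_eq_norm, ← AddCircle.coe_sub, UnitAddCircle.norm_eq] at h
  simp only [a, b] at h
  set k := round (t * Real.log p - if p ∈ T then 0 else 1 / 2)
  by_cases hT : p ∈ T
  · refine ⟨2 * k, by simp [hT], ?_⟩
    rw [if_pos hT] at h
    rw [abs_le]
    rw [abs_lt] at h
    push_cast
    constructor <;> linarith [h.1, h.2]
  · refine ⟨2 * k + 1, by simp [hT], ?_⟩
    rw [if_neg hT] at h
    rw [abs_le]
    rw [abs_lt] at h
    push_cast
    constructor <;> linarith [h.1, h.2]

/-! ### Density of integers with θ log n near a residue modulo 1. -/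

/-- The integers `n` for which `θ log n` is within `δ` of `a` modulo `1`. -/
def nearMod (θ a δ : ℝ) : Set ℕ := {n | ∃ k : ℤ, |θ * Real.log n - a - k| ≤ δ}

theorem cnt_le_sum_of_subset_iUnion {A : Set ℕ} {N K : ℕ} {u v : ℕ → ℝ} (hu : ∀ k, 0 ≤ u k)
    (huv : ∀ k, u k ≤ v k)
    (h : ∀ n : ℕ, 1 ≤ n → n ≤ N → n ∈ A → ∃ k < K, u k ≤ n ∧ (n : ℝ) ≤ v k) :
    (cnt A N : ℝ) ≤ ∑ k ∈ Finset.range K, (v k - u k + 1) := by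
  have h1 : cnt A N ≤
      ((Finset.range K).biUnion fun k => Finset.Icc ⌈u k⌉₊ ⌊v k⌋₊).card := by
    rw [← Set.ncard_coe_finset]
    refine Set.ncard_le_ncard (fun n hn => ?_) (Finset.finite_toSet _)
    obtain ⟨k, hk, h1, h2⟩ := h n hn.2.1 hn.2.2 hn.1
    simp only [Finset.coe_biUnion, Set.mem_iUnion, Finset.mem_coe, Finset.mem_range,
      Finset.mem_Icc]
    exact ⟨k, hk, Nat.ceil_le.2 h1, Nat.le_floor h2⟩
  have h2 : (cnt A N : ℝ) ≤ ∑ k ∈ Finset.range K, ((Finset.Icc ⌈u k⌉₊ ⌊v k⌋₊).card : ℝ) := by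
    exact_mod_cast h1.trans Finset.card_biUnion_le
  refine h2.trans (Finset.sum_le_sum fun k _ => ?_)
  rw [Nat.card_Icc]
  have h3 := Nat.le_ceil (u k)
  have h4 := Nat.floor_le ((hu k).trans (huv k))
  rcases le_total ⌈u k⌉₊ (⌊v k⌋₊ + 1) with h | h
  · rw [Nat.cast_sub h]
    push_cast
    linarith
  · rw [Nat.sub_eq_zero_of_le h]
    push_cast
    linarith [huv k]

/-- The graph of exp lies below its chord over the segment from 0 to x. -/
theorem exp_mul_sub_one_le {s x : ℝ} (hs0 : 0 ≤ s) (hs1 : s ≤ 1) :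
    Real.exp (s * x) - 1 ≤ s * (Real.exp x - 1) := by
  have := convexOn_exp.2 (Set.mem_univ 0) (Set.mem_univ x) (sub_nonneg.2 hs1) hs0 (by ring)
  simp only [smul_eq_mul, mul_zero, zero_add, Real.exp_zero] at this
  linarith

theorem eventually_log_le {θ b ε : ℝ} (hε : 0 < ε) :
    ∀ᶠ N : ℕ in atTop, θ * Real.log N + b ≤ ε * N := by
  have h : (fun x : ℝ => θ * Real.log x + b) =o[atTop] (id : ℝ → ℝ) :=
    (Real.isLittleO_log_id_atTop.const_mul_left θ).add
      (Asymptotics.isLittleO_const_id_atTop b)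
  have h2 := tendsto_natCast_atTop_atTop.eventually (h.bound hε)
  filter_upwards [h2] with N hN
  simp only [id, Real.norm_eq_abs, Nat.abs_cast] at hN
  exact (le_abs_self _).trans hN

/-- The set lies in intervals starting at points `A k` in geometric progression. By convexity each
has length at most 2δ times the gap to `A (k + 1)`, so the lengths telescope to at most 2δ · 7.4 N,
where 7.4 bounds e² and θ ≥ 1/2 is used. The logarithmically many rounding errors cost another δN.
-/
theorem upperDensityLE_nearMod {θ a δ : ℝ} (hθ : 1 / 2 ≤ θ) (ha : a ≤ 1) (hδ : 0 < δ) :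
    UpperDensityLE (nearMod θ a δ) (16 * δ) := by
  rcases le_or_gt (1 / 16) δ with h | hδ1
  · exact upperDensityLE_of_one_le _ (by linarith)
  have hθ0 : 0 < θ := by linarith
  -- The summand 1 shifts the index so that it starts at 0: the integer in `nearMod` can be -1, but
  -- no smaller.
  set b := δ - a + 1 with hb
  have hb0 : 0 ≤ b := by linarith
  let A : ℕ → ℝ := fun k => Real.exp ((k - b) / θ)
  have hA (k : ℕ) : A (k + 1) = A k * Real.exp (1 / θ) := by
    simp only [A, ← Real.exp_add]
    congr 1
    push_cast
    ring
  have hexp : Real.exp (1 / θ) ≤ 7.4 := by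
    have h1 : Real.exp (1 / θ) ≤ Real.exp 2 := by
      refine Real.exp_le_exp.2 ?_
      rw [div_le_iff₀ hθ0]
      linarith
    have h2 : Real.exp 2 = Real.exp 1 * Real.exp 1 := by rw [← Real.exp_add]; norm_num
    nlinarith [Real.exp_one_lt_d9, Real.exp_pos 1]
  filter_upwards [eventually_log_le (θ := θ) (b := b + 1) hδ, eventually_ge_atTop 1] with N hN hN1
  have hNpos : (0 : ℝ) < N := by exact_mod_cast hN1
  have hlogN : 0 ≤ Real.log N := Real.log_natCast_nonneg N
  set K := ⌊θ * Real.log N + b⌋₊ with hK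
  have hKle : (K : ℝ) ≤ θ * Real.log N + b := Nat.floor_le (by positivity)
  have key := cnt_le_sum_of_subset_iUnion (A := nearMod θ a δ) (N := N) (K := K + 1)
    (u := A) (v := fun k => A k * Real.exp (2 * δ * (1 / θ))) (fun k => (Real.exp_pos _).le)
    (fun k => le_mul_of_one_le_right (Real.exp_pos _).le (Real.one_le_exp (by positivity))) ?_
  · have hterm (k : ℕ) : A k * Real.exp (2 * δ * (1 / θ)) - A k + 1
        ≤ 2 * δ * (A (k + 1) - A k) + 1 := by
      have := exp_mul_sub_one_le (s := 2 * δ) (x := 1 / θ) (by positivity) (by linarith)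
      rw [hA]
      nlinarith [Real.exp_pos ((k - b) / θ)]
    have h2 := key.trans (Finset.sum_le_sum fun k _ => hterm k)
    rw [Finset.sum_add_distrib, ← Finset.mul_sum, Finset.sum_range_sub] at h2
    have hAK : A K ≤ N := by
      calc A K ≤ Real.exp (Real.log N) := by
            refine Real.exp_le_exp.2 ?_
            rw [div_le_iff₀ hθ0]
            linarith
        _ = N := Real.exp_log hNpos
    have hAK1 : A (K + 1) ≤ 7.4 * N := by
      rw [hA]
      nlinarith [Real.exp_pos ((K - b) / θ), Real.exp_pos (1 / θ)]
    have hA0 : 0 < A 0 := Real.exp_pos _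
    simp only [Finset.sum_const, Finset.card_range, nsmul_eq_mul, mul_one] at h2
    push_cast at h2
    nlinarith
  · rintro n hn1 hnN ⟨k, hk⟩
    have hnpos : (0 : ℝ) < n := by exact_mod_cast hn1
    have hlogn : 0 ≤ Real.log n := Real.log_natCast_nonneg n
    have hlogle : Real.log n ≤ Real.log N := Real.log_le_log hnpos (by exact_mod_cast hnN)
    obtain ⟨hk1, hk2⟩ := abs_le.1 hk
    have hk0 : -1 < k + 1 := by
      have : (-1 : ℝ) < ((k + 1 : ℤ) : ℝ) := by
        push_cast
        nlinarith [mul_nonneg hθ0.le hlogn]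
      exact_mod_cast this
    obtain ⟨j, hj⟩ := Int.eq_ofNat_of_zero_le (by omega : 0 ≤ k + 1)
    have hjr : (j : ℝ) = k + 1 := by
      have : ((k + 1 : ℤ) : ℝ) = ((j : ℤ) : ℝ) := by rw [hj]
      push_cast at this
      exact this.symm
    refine ⟨j, Nat.lt_succ_of_le (Nat.le_floor ?_), ?_, ?_⟩
    · have := mul_le_mul_of_nonneg_left hlogle hθ0.le
      linarith
    · rw [← Real.le_log_iff_exp_le hnpos, div_le_iff₀ hθ0]
      linarith
    · simp only [A]
      rw [← Real.exp_add, ← Real.log_le_iff_le_exp hnpos, ← mul_one_div, ← add_mul, mul_one_div,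
        le_div_iff₀ hθ0]
      linarith

/-! ### The twisted sets: near stability, separation and interpolation. -/

/-- The positive integers whose prime-to-`3` part is `1` modulo `3`. -/
def threeFreePartOne : Set ℕ := {n | ordCompl[3] n % 3 = 1}

theorem mem_threeFreePartOne_of_not_dvd {n : ℕ} (h : ¬ 3 ∣ n) :
    n ∈ threeFreePartOne ↔ n % 3 = 1 := by
  have : ordCompl[3] n = n :=
    (Nat.ordCompl_eq_self_iff_zero_or_not_dvd n Nat.prime_three).2 (Or.inr h)
  simp only [threeFreePartOne, Set.mem_ofPred_eq, this]

theorem mul_mem_threeFreePartOne {m n : ℕ} (hm : m ≠ 0) (hn : n ≠ 0) :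
    m * n ∈ threeFreePartOne ↔ (m ∈ threeFreePartOne ↔ n ∈ threeFreePartOne) := by
  simp only [threeFreePartOne, Set.mem_ofPred_eq, Nat.ordCompl_mul]
  have h1 := Nat.not_dvd_ordCompl Nat.prime_three hm
  have h2 := Nat.not_dvd_ordCompl Nat.prime_three hn
  rw [Nat.mul_mod]
  rcases (by omega : ordCompl[3] m % 3 = 1 ∨ ordCompl[3] m % 3 = 2) with h | h <;>
  rcases (by omega : ordCompl[3] n % 3 = 1 ∨ ordCompl[3] n % 3 = 2) with h' | h' <;>
  simp [h, h']

/-- The integer part of `θ' x` where its fractional part is below `c`, that of `θ x` elsewhere. -/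
noncomputable def mixFloor (θ θ' c x : ℝ) : ℤ :=
  if Int.fract (θ' * x) < c then ⌊θ' * x⌋ else ⌊θ * x⌋

/-- A set on which membership is the product of the sign of the character modulo `3` and of a
slowly varying sign. -/
def twistedSet (θ θ' c : ℝ) : Set ℕ :=
  {n | n ≠ 0 ∧ (n ∈ threeFreePartOne ↔ Even (mixFloor θ θ' c (Real.log n)))}

/-- The integers at which the slowly varying sign of `twistedSet θ θ' c` may be unstable. -/
def edgeSet (θ θ' c δ : ℝ) : Set ℕ := nearMod θ 0 δ ∪ (nearMod θ' 0 δ ∪ nearMod θ' c δ)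

/-- A point farther than δ from every integer crosses none when moved by at most δ. -/
theorem floor_eq_of_near {z z' δ : ℝ} {m : ℤ} (h : |z' - z - m| ≤ δ) (hz : ¬ ∃ k : ℤ, |z - k| ≤ δ) :
    ⌊z'⌋ = ⌊z⌋ + m := by
  push Not at hz
  have h0 := hz ⌊z⌋
  have h1 := hz (⌊z⌋ + 1)
  have h2 := Int.floor_le z
  have h3 := Int.lt_floor_add_one z
  rw [abs_of_nonneg (by linarith)] at h0
  push_cast at h1
  rw [abs_of_neg (by linarith)] at h1
  rw [abs_le] at h
  rw [Int.floor_eq_iff]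
  push_cast
  constructor <;> linarith [h.1, h.2]

theorem fract_lt_iff_of_near {z z' c δ : ℝ} {m : ℤ} (h : |z' - z - m| ≤ δ)
    (hz : ¬ ∃ k : ℤ, |z - k| ≤ δ) (hc : ¬ ∃ k : ℤ, |z - c - k| ≤ δ) :
    Int.fract z' < c ↔ Int.fract z < c := by
  have h1 := floor_eq_of_near h hz
  push Not at hc
  have h2 := hc ⌊z⌋
  rw [abs_le] at h
  have h3 : (⌊z'⌋ : ℝ) = ⌊z⌋ + m := by rw [h1]; push_cast; ring
  unfold Int.fract
  rw [h3]
  rcases lt_abs.1 h2 with h4 | h4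
  · constructor <;> intro h5 <;> linarith [h.1, h.2]
  · constructor <;> intro h5 <;> linarith [h.1, h.2]

/-- Off the edge set, x and y fall in the same branch of `mixFloor`, since the branch depends only
on θ'x modulo 1. Equal parity of m and m' makes the sign change independent of the branch. This
serves both for multiplication by a prime and for small shifts, where m = m' = 0. -/
theorem even_mixFloor_add {θ θ' c δ x y : ℝ} {m m' : ℤ} {n : ℕ} (hx : x = Real.log n)
    (hn : n ∉ edgeSet θ θ' c δ) (h : |θ * (y - x) - m| ≤ δ) (h' : |θ' * (y - x) - m'| ≤ δ)
    (hm : Even m ↔ Even m') :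
    Even (mixFloor θ θ' c y) ↔ (Even (mixFloor θ θ' c x) ↔ Even m) := by
  subst hx
  simp only [edgeSet, nearMod, Set.mem_union, Set.mem_ofPred_eq, not_or, sub_zero] at hn
  obtain ⟨h1, h2, h3⟩ := hn
  rw [mul_sub] at h h'
  unfold mixFloor
  simp only [fract_lt_iff_of_near h' h2 h3, floor_eq_of_near h' h2, floor_eq_of_near h h1]
  split_ifs
  · rw [Int.even_add, hm]
  · rw [Int.even_add]

theorem mul_mem_twistedSet {θ θ' c δ : ℝ} {m m' : ℤ} {p n : ℕ} (hp : p ≠ 0) (hn0 : n ≠ 0)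
    (hn : n ∉ edgeSet θ θ' c δ) (h : |θ * Real.log p - m| ≤ δ) (h' : |θ' * Real.log p - m'| ≤ δ)
    (hm : Even m ↔ p ∈ threeFreePartOne) (hm' : Even m' ↔ p ∈ threeFreePartOne) :
    n ∈ twistedSet θ θ' c ↔ p * n ∈ twistedSet θ θ' c := by
  have hlog : Real.log ((p * n : ℕ) : ℝ) - Real.log n = Real.log p := by
    rw [Nat.cast_mul, Real.log_mul (by exact_mod_cast hp) (by exact_mod_cast hn0)]
    ring
  have key := even_mixFloor_add (y := Real.log ((p * n : ℕ) : ℝ)) rfl hn (by rwa [hlog])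
    (by rwa [hlog]) (hm.trans hm'.symm)
  simp only [twistedSet, Set.mem_ofPred_eq]
  rw [key, mul_mem_threeFreePartOne hp hn0, hm]
  have := mul_ne_zero hp hn0
  tauto

/-- The integers at which `S` does not separate two nearby opposite classes modulo `3`. -/
def unseparated (S : Set ℕ) : Set ℕ :=
  {n | n % 3 = 1 ∧ (n ∈ S ↔ n + 1 ∈ S) ∨ n % 3 = 2 ∧ (n ∈ S ↔ n + 2 ∈ S)}

theorem even_mixFloor_shift {θ θ' c δ : ℝ} {n j : ℕ} (hθ : 0 ≤ θ) (hθ' : 0 ≤ θ') (hn0 : n ≠ 0)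
    (hj : j ≤ 2) (hn : n ∉ edgeSet θ θ' c δ) (h : 2 * θ ≤ δ * n) (h' : 2 * θ' ≤ δ * n) :
    Even (mixFloor θ θ' c (Real.log ((n + j : ℕ) : ℝ))) ↔ Even (mixFloor θ θ' c (Real.log n)) := by
  have hn1 : (0 : ℝ) < n := by exact_mod_cast Nat.pos_of_ne_zero hn0
  have hd0 : 0 ≤ Real.log ((n + j : ℕ) : ℝ) - Real.log n :=
    sub_nonneg.2 (Real.log_le_log hn1 (by exact_mod_cast Nat.le_add_right n j))
  have hd : Real.log ((n + j : ℕ) : ℝ) - Real.log n ≤ 2 / n := by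
    rw [← Real.log_div (by positivity) hn1.ne']
    refine (Real.log_le_sub_one_of_pos (by positivity)).trans ?_
    have : (j : ℝ) ≤ 2 := by exact_mod_cast hj
    push_cast
    rw [div_sub_one hn1.ne', add_sub_cancel_left]
    gcongr
  have bound {t : ℝ} (ht : 0 ≤ t) (h : 2 * t ≤ δ * n) :
      |t * (Real.log ((n + j : ℕ) : ℝ) - Real.log n) - (0 : ℤ)| ≤ δ := by
    rw [Int.cast_zero, sub_zero, abs_of_nonneg (mul_nonneg ht hd0)]
    calc _ ≤ t * (2 / n) := by gcongr
      _ = 2 * t / n := by ring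
      _ ≤ δ := by rwa [div_le_iff₀ hn1]
  rw [even_mixFloor_add rfl hn (bound hθ h) (bound hθ' h') Iff.rfl]
  simp

theorem notMem_unseparated {θ θ' c δ : ℝ} {n : ℕ} (hθ : 0 ≤ θ) (hθ' : 0 ≤ θ') (hn0 : n ≠ 0)
    (hn : n ∉ edgeSet θ θ' c δ) (h : 2 * θ ≤ δ * n) (h' : 2 * θ' ≤ δ * n) :
    n ∉ unseparated (twistedSet θ θ' c) := by
  have h1 := even_mixFloor_shift hθ hθ' hn0 (j := 1) (by omega) hn h h'
  have h2 := even_mixFloor_shift hθ hθ' hn0 (j := 2) le_rfl hn h h'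
  rintro (⟨h3, h4⟩ | ⟨h3, h4⟩)
  · simp only [twistedSet, Set.mem_ofPred_eq, h1] at h4
    rw [mem_threeFreePartOne_of_not_dvd (by omega), mem_threeFreePartOne_of_not_dvd (by omega)]
      at h4
    have : ¬ (n + 1) % 3 = 1 := by omega
    tauto
  · simp only [twistedSet, Set.mem_ofPred_eq, h2] at h4
    rw [mem_threeFreePartOne_of_not_dvd (by omega), mem_threeFreePartOne_of_not_dvd (by omega)]
      at h4
    have : (n + 2) % 3 = 1 := by omega
    have : ¬ n % 3 = 1 := by omega
    tauto

theorem upperDensityLE_edgeSet {θ θ' c δ : ℝ} (hθ : 1 / 2 ≤ θ) (hθ' : 1 / 2 ≤ θ') (hc : c ≤ 1)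
    (hδ : 0 < δ) : UpperDensityLE (edgeSet θ θ' c δ) (48 * δ) :=
  ((upperDensityLE_nearMod hθ zero_le_one hδ).union
    ((upperDensityLE_nearMod hθ' zero_le_one hδ).union
    (upperDensityLE_nearMod hθ' hc hδ))).subset subset_rfl (by linarith)

/-- Only integers whose fractional part of θ' log n lies in [c, c') switch branch, and these are
within (c' - c)/2 of the midpoint modulo 1. -/
theorem upperDensityLE_symmDiff_twistedSet {θ θ' c c' : ℝ} (hθ' : 1 / 2 ≤ θ') (hc : c < c')
    (hc' : c' ≤ 1) :
    UpperDensityLE (symmDiff (twistedSet θ θ' c) (twistedSet θ θ' c')) (8 * (c' - c)) := by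
  refine (upperDensityLE_nearMod hθ' (a := (c + c') / 2) (δ := (c' - c) / 2) (by linarith)
    (by linarith)).subset (fun n hn => ?_) (by linarith)
  by_contra hcon
  simp only [nearMod, Set.mem_ofPred_eq, not_exists, not_le] at hcon
  have h := hcon ⌊θ' * Real.log n⌋
  have h2 : Int.fract (θ' * Real.log n) < c ↔ Int.fract (θ' * Real.log n) < c' := by
    unfold Int.fract
    rcases lt_abs.1 h with h | h
    · constructor <;> intro h5 <;> linarith
    · constructor <;> intro h5 <;> linarith
  have h3 : mixFloor θ θ' c (Real.log n) = mixFloor θ θ' c' (Real.log n) := by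
    simp only [mixFloor, h2]
  simp only [Set.mem_symmDiff, twistedSet, Set.mem_ofPred_eq, h3] at hn
  tauto

/-- The passage from θ to θ' ends exactly where the passage from θ' to θ'' begins. -/
theorem twistedSet_one (θ θ' θ'' : ℝ) : twistedSet θ θ' 1 = twistedSet θ' θ'' 0 := by
  simp only [twistedSet, mixFloor, Int.fract_lt_one, if_true, not_lt.2 (Int.fract_nonneg _),
    if_false]

/-! ### The slowly varying sequence. -/

/-- A sequence of sets that are ever more nearly stable and separating, and vary ever more
slowly. -/
theorem exists_slowly_varying_seq : ∃ (G : ℕ → Set ℕ) (e : ℕ → ℝ), (∀ i, 0 < e i) ∧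
    Tendsto e atTop (𝓝 0) ∧ (∀ i, 0 ∉ G i) ∧
    (∀ p : ℕ, p.Prime → ∀ᶠ i in atTop, UpperDensityLE {n | ¬ (n ∈ G i ↔ p * n ∈ G i)} (e i)) ∧
    (∀ i, UpperDensityLE (unseparated (G i)) (e i)) ∧
    ∀ i, UpperDensityLE (symmDiff (G i) (G (i + 1))) (e i) := by
  have hex (k : ℕ) : ∃ θ : ℝ, 1 / 2 ≤ θ ∧ ∀ p : ℕ, p.Prime → p ≤ k + 3 → ∃ m : ℤ,
      (Even m ↔ p ∈ threeFreePartOne) ∧ |θ * Real.log p - m| ≤ 1 / ((k : ℝ) + 3) := by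
    obtain ⟨θ, hθ⟩ := exists_mul_log_prime_near threeFreePartOne
      (s := (Finset.range (k + 4)).filter Nat.Prime) (fun p hp => (Finset.mem_filter.1 hp).2)
      (ε := 1 / ((k : ℝ) + 3)) (by positivity)
    -- Negating θ preserves the parities. The prime 2 has sign -1, so its integer is odd; hence |θ|
    -- log 2 ≥ 2/3, which bounds |θ| from below.
    refine ⟨|θ|, ?_, fun p hp hpk => ?_⟩
    · obtain ⟨m, hm, hm'⟩ := hθ 2 (by simp [Nat.prime_two])
      have h2 : ¬ Even m := by
        rw [hm, mem_threeFreePartOne_of_not_dvd (by norm_num)]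
        norm_num
      have h3 : (1 : ℝ) ≤ |(m : ℝ)| := by
        have : m ≠ 0 := by rintro rfl; exact h2 Even.zero
        exact_mod_cast Int.one_le_abs this
      have h4 : 1 / ((k : ℝ) + 3) ≤ 1 / 3 := by
        gcongr
        have : (0 : ℝ) ≤ k := Nat.cast_nonneg k
        linarith
      have h5 := abs_sub_abs_le_abs_sub (m : ℝ) (θ * Real.log (2 : ℕ))
      rw [abs_sub_comm] at h5
      have h6 : (2 : ℝ) / 3 ≤ |θ * Real.log (2 : ℕ)| := by
        linarith [h5.trans (hm'.trans h4)]
      rw [abs_mul, Nat.cast_ofNat, abs_of_pos (Real.log_pos one_lt_two)] at h6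
      nlinarith [Real.log_two_lt_d9, abs_nonneg θ]
    · obtain ⟨m, hm, hm'⟩ := hθ p
        (Finset.mem_filter.2 ⟨Finset.mem_range.2 (by omega), hp⟩)
      rcases abs_choice θ with h | h
      · exact ⟨m, hm, by rwa [h]⟩
      · refine ⟨-m, by rwa [even_neg], ?_⟩
        rw [h, ← abs_neg]
        push_cast
        rwa [show -(-θ * Real.log p - -(m : ℝ)) = θ * Real.log p - m by ring]
  choose θ hθ1 hθ2 using hex
  -- For k² ≤ i < (k+1)² the threshold rises from 0 in steps of 1/(2k+1); one more step would reach
  -- 1, where the next block starts.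
  let c : ℕ → ℝ := fun i => ((i : ℝ) - (i.sqrt : ℝ) ^ 2) / (2 * i.sqrt + 1)
  let G : ℕ → Set ℕ := fun i => twistedSet (θ i.sqrt) (θ (i.sqrt + 1)) (c i)
  -- The value exceeds the edge bound 48δ, as `UpperDensityLE.mono` needs strictness, and also
  -- covers the drift 8/(2k+1).
  let e : ℕ → ℝ := fun i => 49 / ((i.sqrt : ℝ) + 3)
  have hc (i : ℕ) : c i + 1 / (2 * i.sqrt + 1) ≤ 1 := by
    have h : (i : ℝ) + 1 ≤ (i.sqrt + 1) * (i.sqrt + 1) := by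
      exact_mod_cast Nat.lt_succ_sqrt i
    simp only [c]
    rw [← add_div, div_le_one (by positivity)]
    nlinarith
  have hinv (i : ℕ) : (0 : ℝ) < 1 / (2 * i.sqrt + 1) := by positivity
  have hk (i : ℕ) : (48 : ℝ) * (1 / ((i.sqrt : ℝ) + 3)) < e i := by
    simp only [e]
    rw [mul_one_div]
    gcongr
    norm_num
  have hmono (k : ℕ) : 1 / (((k + 1 : ℕ) : ℝ) + 3) ≤ 1 / ((k : ℝ) + 3) := by
    gcongr
    linarith
  have hsqrt : Tendsto Nat.sqrt atTop atTop := by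
    refine tendsto_atTop.2 fun b => ?_
    filter_upwards [eventually_ge_atTop (b * b)] with i hi
    exact Nat.le_sqrt.2 hi
  refine ⟨G, e, fun i => by positivity, ?_, fun i h => h.1 rfl, fun p hp => ?_, fun i => ?_,
    fun i => ?_⟩
  · refine Tendsto.const_div_atTop ?_ 49
    exact tendsto_atTop_add_const_right _ _ (tendsto_natCast_atTop_atTop.comp hsqrt)
  · filter_upwards [hsqrt.eventually_ge_atTop p] with i hi
    obtain ⟨m, hm1, hm2⟩ := hθ2 i.sqrt p hp (by omega)
    obtain ⟨m', hm1', hm2'⟩ := hθ2 (i.sqrt + 1) p hp (by omega)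
    refine (upperDensityLE_edgeSet (c := c i) (hθ1 i.sqrt) (hθ1 (i.sqrt + 1))
      (by linarith [hc i, hinv i]) (by positivity : (0 : ℝ) < 1 / ((i.sqrt : ℝ) + 3))).mono ?_ (hk i)
    filter_upwards [eventually_ne_atTop 0] with n hn0 hn
    by_contra hcon
    exact hn (mul_mem_twistedSet hp.ne_zero hn0 hcon hm2 (hm2'.trans (hmono _)) hm1 hm1')
  · refine (upperDensityLE_edgeSet (c := c i) (hθ1 i.sqrt) (hθ1 (i.sqrt + 1))
      (by linarith [hc i, hinv i]) (by positivity : (0 : ℝ) < 1 / ((i.sqrt : ℝ) + 3))).mono ?_ (hk i)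
    have hlim (t : ℝ) : ∀ᶠ n : ℕ in atTop, t ≤ 1 / ((i.sqrt : ℝ) + 3) * n :=
      (tendsto_natCast_atTop_atTop.const_mul_atTop (by positivity)).eventually_ge_atTop _
    filter_upwards [eventually_ne_atTop 0, hlim (2 * θ i.sqrt), hlim (2 * θ (i.sqrt + 1))]
      with n hn0 h1 h2 hn
    by_contra hcon
    exact notMem_unseparated (by linarith [hθ1 i.sqrt]) (by linarith [hθ1 (i.sqrt + 1)]) hn0 hcon
      h1 h2 hn
  · have hstep : G (i + 1) = twistedSet (θ i.sqrt) (θ (i.sqrt + 1)) (c i + 1 / (2 * i.sqrt + 1)) := by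
      have h1 := Nat.sqrt_le i
      have h2 := Nat.lt_succ_sqrt i
      rcases (Nat.succ_le_of_lt h2).lt_or_eq with h | h
      · have hs : (i + 1).sqrt = i.sqrt := Nat.eq_sqrt.2 ⟨by omega, h⟩ |>.symm
        simp only [G, c, hs]
        congr 1
        push_cast
        ring
      · rw [Nat.succ_eq_add_one, Nat.succ_eq_add_one] at h
        have hs : (i + 1).sqrt = i.sqrt + 1 := by rw [h, Nat.sqrt_eq]
        have hr : (i : ℝ) + 1 = (i.sqrt + 1) * (i.sqrt + 1) := by exact_mod_cast h
        have hc0 : c (i + 1) = 0 := by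
          simp only [c, hs]
          push_cast
          rw [hr]
          ring
        have hc1 : c i + 1 / (2 * i.sqrt + 1) = 1 := by
          simp only [c]
          rw [← add_div, div_eq_one_iff_eq (by positivity)]
          linarith
        rw [hc1, twistedSet_one _ _ (θ (i.sqrt + 1 + 1))]
        simp only [G, hc0, hs]
    rw [hstep]
    refine (upperDensityLE_symmDiff_twistedSet (hθ1 (i.sqrt + 1)) (lt_add_of_pos_right _ (hinv i))
      (hc i)).subset subset_rfl ?_
    simp only [e, add_sub_cancel_left]
    rw [mul_one_div, div_le_div_iff₀ (by positivity) (by positivity)]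
    have : (0 : ℝ) ≤ i.sqrt := Nat.cast_nonneg _
    linarith

/-! ### Gluing along breakpoints. -/

theorem exists_breakpoints {e : ℕ → ℝ} (he : ∀ i, 0 < e i) (M : ℕ → ℕ) :
    ∃ N : ℕ → ℕ, N 0 = 0 ∧ StrictMono N ∧
      ∀ i, (N i : ℝ) ≤ e i * N (i + 1) ∧ M (i + 1) ≤ N (i + 1) := by
  let step : ℕ → ℕ → ℕ := fun i a => a + 1 + M (i + 1) + ⌈(a : ℝ) / e i⌉₊
  let N : ℕ → ℕ := fun i => Nat.rec (motive := fun _ => ℕ) 0 step i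
  have hN (i : ℕ) : N (i + 1) = N i + 1 + M (i + 1) + ⌈(N i : ℝ) / e i⌉₊ := by rfl
  refine ⟨N, rfl, strictMono_nat_of_lt_succ fun i => by rw [hN]; omega, fun i => ⟨?_, ?_⟩⟩
  · have h1 : (⌈(N i : ℝ) / e i⌉₊ : ℝ) ≤ N (i + 1) := by
      exact_mod_cast (by rw [hN]; omega : ⌈(N i : ℝ) / e i⌉₊ ≤ N (i + 1))
    have h2 := (Nat.le_ceil ((N i : ℝ) / e i)).trans h1
    rw [div_le_iff₀ (he i)] at h2
    linarith
  · rw [hN]; omega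

theorem exists_index_of_strictMono {N : ℕ → ℕ} (h0 : N 0 = 0) (hN : StrictMono N) :
    ∃ idx : ℕ → ℕ, ∀ n, N (idx n) ≤ n ∧ n < N (idx n + 1) := by
  have h (n : ℕ) : ∃ i, N i ≤ n ∧ n < N (i + 1) := by
    have hex : ∃ i, n < N (i + 1) := ⟨n, (Nat.lt_succ_self n).trans_le (hN.id_le (n + 1))⟩
    classical
    refine ⟨Nat.find hex, ?_, Nat.find_spec hex⟩
    rcases Nat.eq_zero_or_pos (Nat.find hex) with h | h
    · rw [h, h0]; omega
    · have := Nat.find_min hex (Nat.sub_lt h one_pos)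
      rw [Nat.sub_add_cancel (Nat.one_le_of_lt h)] at this
      omega
  choose idx hidx using h
  exact ⟨idx, hidx⟩

theorem index_eq {N : ℕ → ℕ} (hN : StrictMono N) {i j n : ℕ} (hi : N i ≤ n) (hi' : n < N (i + 1))
    (hj : N j ≤ n) (hj' : n < N (j + 1)) : i = j := by
  have h1 := hN.lt_iff_lt.1 (hi.trans_lt hj')
  have h2 := hN.lt_iff_lt.1 (hj.trans_lt hi')
  omega

/-- Sets which vary slowly along a sequence can be glued along rapidly increasing breakpoints into
one set that at every scale is close to a member of the sequence. -/
theorem exists_glued_set {G : ℕ → Set ℕ} {e : ℕ → ℝ} (he : ∀ i, 0 < e i) (hG0 : ∀ i, 0 ∉ G i)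
    (hG : ∀ i, UpperDensityLE (symmDiff (G i) (G (i + 1))) (e i)) (M : ℕ → ℕ) :
    ∃ (S : Set ℕ) (idx : ℕ → ℕ), 0 ∉ S ∧ Tendsto idx atTop atTop ∧
      ∀ n, idx n ≠ 0 → M (idx n) ≤ n ∧
        (cnt (symmDiff S (G (idx n))) n : ℝ) ≤ 2 * e (idx n - 1) * n := by
  choose M' hM' using fun i => eventually_atTop.1 (hG i)
  obtain ⟨N, hN0, hN, hNe⟩ := exists_breakpoints he (fun i => M i + M' (i - 1))
  obtain ⟨idx, hidx⟩ := exists_index_of_strictMono hN0 hN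
  refine ⟨{n | n ∈ G (idx n)}, idx, hG0 _, ?_, fun n hn => ?_⟩
  · refine tendsto_atTop.2 fun b => ?_
    filter_upwards [eventually_ge_atTop (N b)] with n hn
    have := hN.lt_iff_lt.1 (hn.trans_lt (hidx n).2)
    omega
  · obtain ⟨i, hi⟩ := Nat.exists_eq_succ_of_ne_zero hn
    rw [Nat.succ_eq_add_one] at hi
    have h1 := hidx n
    rw [hi] at h1 ⊢
    obtain ⟨h2, h3⟩ := hNe i
    simp only [add_tsub_cancel_right] at h3 ⊢
    have h4 := hM' i n (by omega)
    refine ⟨by omega, ?_⟩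
    -- Up to n, the glued set agrees with `G (i + 1)` on the current block and with `G i` on the
    -- previous one. Everything earlier lies below `N i`, which is at most `e i * n`.
    have hsub : cnt (symmDiff {n | n ∈ G (idx n)} (G (i + 1))) n ≤
        cnt (Set.Iic (N i) ∪ symmDiff (G i) (G (i + 1))) n := cnt_le_of_imp fun m _ hmn hm => by
      by_cases hmi : m < N i
      · exact Or.inl hmi.le
      right
      by_cases hmi1 : m < N (i + 1)
      · have : idx m = i := index_eq hN (hidx m).1 (hidx m).2 (by omega) hmi1
        simpa [Set.mem_symmDiff, this] using hm
      · have : idx m = i + 1 := index_eq hN (hidx m).1 (hidx m).2 (by omega) (by omega)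
        simp [Set.mem_symmDiff, this] at hm
    have hIic : cnt (Set.Iic (N i)) n ≤ N i := by
      calc cnt (Set.Iic (N i)) n ≤ cnt Set.univ (N i) :=
            Set.ncard_le_ncard (fun n hn => ⟨trivial, hn.2.1, hn.1⟩) (finite_inter_Icc _ _)
        _ ≤ N i := cnt_le _ _
    have h5 : (cnt (symmDiff {n | n ∈ G (idx n)} (G (i + 1))) n : ℝ) ≤
        N i + cnt (symmDiff (G i) (G (i + 1))) n := by
      exact_mod_cast hsub.trans ((cnt_union_le _ _ _).trans (by omega))
    have h6 : e i * (N (i + 1) : ℝ) ≤ e i * n :=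
      mul_le_mul_of_nonneg_left (by exact_mod_cast h1.1) (he i).le
    linarith

/-! ### A stable set with negligible unseparated part. -/

/-- Both n and pn are compared with the same model A, so A must approximate S up to pN. -/
theorem cnt_not_iff_mul_le (S A : Set ℕ) {p : ℕ} (hp : p ≠ 0) (N : ℕ) :
    cnt {n | ¬ (n ∈ S ↔ p * n ∈ S)} N ≤
      cnt {n | ¬ (n ∈ A ↔ p * n ∈ A)} N + 2 * cnt (symmDiff S A) (p * N) := by
  have h1 : cnt {n | ¬ (n ∈ S ↔ p * n ∈ S)} N ≤ cnt ({n | ¬ (n ∈ A ↔ p * n ∈ A)} ∪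
      (symmDiff S A ∪ {n | p * n ∈ symmDiff S A})) N := cnt_le_of_imp fun n _ _ hn => by
    simp only [Set.mem_union, Set.mem_symmDiff, Set.mem_ofPred_eq] at hn ⊢
    tauto
  have h2 := cnt_union_le {n | ¬ (n ∈ A ↔ p * n ∈ A)} (symmDiff S A ∪ {n | p * n ∈ symmDiff S A}) N
  have h3 := cnt_union_le (symmDiff S A) {n | p * n ∈ symmDiff S A} N
  have h4 := cnt_mono_right (symmDiff S A) (Nat.le_mul_of_pos_left N (Nat.pos_of_ne_zero hp))
  have h5 : cnt {n | p * n ∈ symmDiff S A} N ≤ cnt (symmDiff S A) (p * N) :=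
    cnt_le_of_injective (p * ·) (fun a b h => Nat.eq_of_mul_eq_mul_left (Nat.pos_of_ne_zero hp) h)
      fun n hn1 hnN hn => ⟨hn, Nat.mul_pos (Nat.pos_of_ne_zero hp) hn1, Nat.mul_le_mul_left p hnN⟩
  omega

theorem cnt_unseparated_le (S A : Set ℕ) (N : ℕ) :
    cnt (unseparated S) N ≤ cnt (unseparated A) N + 3 * cnt (symmDiff S A) (3 * N) := by
  have h1 : cnt (unseparated S) N ≤ cnt (unseparated A ∪ (symmDiff S A ∪
      ({n | n + 1 ∈ symmDiff S A} ∪ {n | n + 2 ∈ symmDiff S A}))) N :=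
    cnt_le_of_imp fun n _ _ hn => by
      simp only [unseparated, Set.mem_union, Set.mem_symmDiff, Set.mem_ofPred_eq] at hn ⊢
      tauto
  have h2 := cnt_union_le (unseparated A) (symmDiff S A ∪
      ({n | n + 1 ∈ symmDiff S A} ∪ {n | n + 2 ∈ symmDiff S A})) N
  have h3 := cnt_union_le (symmDiff S A)
      ({n | n + 1 ∈ symmDiff S A} ∪ {n | n + 2 ∈ symmDiff S A}) N
  have h4 := cnt_union_le {n | n + 1 ∈ symmDiff S A} {n | n + 2 ∈ symmDiff S A} N
  have h5 := cnt_mono_right (symmDiff S A) (by omega : N ≤ 3 * N)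
  have h6 (j : ℕ) (hj : j ≤ 2) : cnt {n | n + j ∈ symmDiff S A} N ≤ cnt (symmDiff S A) (3 * N) :=
    cnt_le_of_injective (· + j) (add_left_injective j)
      fun n hn1 hnN hn => ⟨hn, by omega, by omega⟩
  have := h6 1 (by omega)
  have := h6 2 (by omega)
  omega

/-- There is a stable set which almost always separates nearby opposite classes modulo `3`. -/
theorem exists_isStable_unseparated : ∃ S : Set ℕ, 0 ∉ S ∧ IsStable S ∧
    HasDensity (unseparated S) 0 := by
  obtain ⟨G, e, he, he0, hG0, hp, hu, hd⟩ := exists_slowly_varying_seq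
  have hM (i : ℕ) : ∃ M : ℕ, ∀ N ≥ M, (cnt (unseparated (G i)) N : ℝ) ≤ e i * N ∧
      ∀ p ≤ i, UpperDensityLE {n | ¬ (n ∈ G i ↔ p * n ∈ G i)} (e i) →
        (cnt {n | ¬ (n ∈ G i ↔ p * n ∈ G i)} N : ℝ) ≤ e i * N := by
    refine eventually_atTop.1 ((hu i).and ?_)
    refine (eventually_all_finite (Set.finite_Iic i)).2 fun p _ => ?_
    by_cases h : UpperDensityLE {n | ¬ (n ∈ G i ↔ p * n ∈ G i)} (e i)
    · filter_upwards [h] with N hN _ using hN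
    · exact Eventually.of_forall fun N h' => absurd h' h
  choose M hM using hM
  -- The model is chosen at scale qN but its bounds are needed at N. Once the index is at least q,
  -- the factor i turns `i * M i ≤ q * N` into `M i ≤ N`.
  obtain ⟨S, idx, hS0, hidx, hS⟩ := exists_glued_set he hG0 hd (fun i => i * M i)
  have hmul {q : ℕ} (hq : q ≠ 0) : Tendsto (fun N => idx (q * N)) atTop atTop :=
    hidx.comp (tendsto_id.const_mul_atTop' (Nat.pos_of_ne_zero hq))
  have hsmall {q : ℕ} (hq : q ≠ 0) {ε : ℝ} (hε : 0 < ε) : ∀ᶠ N in atTop,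
      M (idx (q * N)) ≤ N ∧ e (idx (q * N)) ≤ ε ∧
      (cnt (symmDiff S (G (idx (q * N)))) (q * N) : ℝ) ≤ ε * N := by
    have hq0 : (0 : ℝ) < q := by exact_mod_cast Nat.pos_of_ne_zero hq
    have h1 := (he0.comp (hmul hq)).eventually (eventually_le_nhds hε)
    have h2 := (he0.comp ((tendsto_sub_atTop_nat 1).comp (hmul hq))).eventually
      (eventually_le_nhds (show (0 : ℝ) < ε / (2 * q) by positivity))
    filter_upwards [h1, h2, (hmul hq).eventually_ge_atTop q, (hmul hq).eventually_ne_atTop 0]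
      with N h1 h2 h3 h4
    obtain ⟨h5, h6⟩ := hS _ h4
    refine ⟨?_, h1, h6.trans ?_⟩
    · exact Nat.le_of_mul_le_mul_left ((Nat.mul_le_mul_right _ h3).trans h5)
        (Nat.pos_of_ne_zero hq)
    · simp only [Function.comp] at h2
      push_cast
      calc 2 * e (idx (q * N) - 1) * (q * N) ≤ 2 * (ε / (2 * q)) * (q * N) := by gcongr
        _ = ε * N := by field_simp
  refine ⟨S, hS0, fun p hpp => hasDensity_zero_iff.2 fun ε hε => ?_,
    hasDensity_zero_iff.2 fun ε hε => ?_⟩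
  · filter_upwards [hsmall hpp.ne_zero (show (0 : ℝ) < ε / 3 by positivity),
      (hmul hpp.ne_zero).eventually (hp p hpp), (hmul hpp.ne_zero).eventually_ge_atTop p]
      with N h1 h2 h3
    have h4 := (hM _ N h1.1).2 p h3 h2
    have h5 := (Nat.cast_le (α := ℝ)).2 (cnt_not_iff_mul_le S (G (idx (p * N))) hpp.ne_zero N)
    push_cast at h5
    have h6 := mul_le_mul_of_nonneg_right h1.2.1 (Nat.cast_nonneg N : (0 : ℝ) ≤ N)
    linarith [h1.2.2]
  · filter_upwards [hsmall three_ne_zero (show (0 : ℝ) < ε / 4 by positivity)] with N h1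
    have h4 := (hM _ N h1.1).1
    have h5 := (Nat.cast_le (α := ℝ)).2 (cnt_unseparated_le S (G (idx (3 * N))) N)
    push_cast at h5
    have h6 := mul_le_mul_of_nonneg_right h1.2.1 (Nat.cast_nonneg N : (0 : ℝ) ≤ N)
    linarith [h1.2.2]

/-! ### Separation and stability at 3 force density 1/2. -/

open Classical in
/-- The excess of members of `S` over nonmembers among `1, …, N`. -/
noncomputable def excess (S : Set ℕ) (N : ℕ) : ℤ :=
  ∑ n ∈ Finset.range N, if n + 1 ∈ S then 1 else -1

theorem two_mul_cnt_eq (S : Set ℕ) (N : ℕ) : 2 * (cnt S N : ℤ) = N + excess S N := by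
  classical
  have h : cnt S N = ((Finset.range N).filter (fun n => n + 1 ∈ S)).card := by
    unfold cnt
    rw [← Set.ncard_coe_finset, ← Set.ncard_image_of_injective
      (((Finset.range N).filter (fun n => n + 1 ∈ S) : Finset ℕ) : Set ℕ) (add_left_injective 1)]
    congr 1
    ext n
    rw [Finset.coe_filter]
    constructor
    · rintro ⟨h1, h2, h3⟩
      exact ⟨n - 1, ⟨Finset.mem_range.2 (by omega), by rwa [Nat.sub_add_cancel h2]⟩,
        Nat.sub_add_cancel h2⟩
    · rintro ⟨m, ⟨h1, h2⟩, rfl⟩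
      exact ⟨h2, Nat.succ_pos m, Finset.mem_range.1 h1⟩
  rw [h, Finset.card_filter]
  unfold excess
  push_cast
  rw [Finset.mul_sum]
  have : (N : ℤ) = ∑ n ∈ Finset.range N, 1 := by simp
  conv_rhs => rw [this]
  rw [← Finset.sum_add_distrib]
  refine Finset.sum_congr rfl fun n _ => ?_
  split_ifs <;> norm_num

theorem cnt_succ (A : Set ℕ) (N : ℕ) [Decidable (N + 1 ∈ A)] :
    cnt A (N + 1) = cnt A N + if N + 1 ∈ A then 1 else 0 := by
  have h1 := two_mul_cnt_eq A (N + 1)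
  have h2 := two_mul_cnt_eq A N
  unfold excess at h1 h2
  rw [Finset.sum_range_succ] at h1
  split_ifs at h1 ⊢ <;> push_cast at h1 <;> omega

theorem abs_excess_le (S : Set ℕ) (N : ℕ) : |excess S N| ≤ N := by
  refine (Finset.abs_sum_le_sum_abs _ _).trans ?_
  calc _ ≤ ∑ n ∈ Finset.range N, (1 : ℤ) := Finset.sum_le_sum fun n _ => by split_ifs <;> simp
    _ = N := by simp

/-- The signs at 3m+1 and 3m+2 cancel and the sign at 3m equals that at m; each exception costs at
most 2. -/
theorem abs_excess_three_mul_sub_le (S : Set ℕ) (M : ℕ) :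
    |excess S (3 * M) - excess S M| ≤
      2 * cnt {n | ¬ (n ∈ S ↔ 3 * n ∈ S)} M + 2 * cnt (unseparated S) (3 * M) := by
  classical
  induction M with
  | zero =>
    simp only [excess, Nat.mul_zero, Finset.range_zero, Finset.sum_empty, sub_self, abs_zero]
    positivity
  | succ M ih =>
    have h1 := cnt_succ {n | ¬ (n ∈ S ↔ 3 * n ∈ S)} M
    have h2 := cnt_succ (unseparated S) (3 * M)
    have h3 := cnt_mono_right (unseparated S) (by omega : 3 * M + 1 ≤ 3 * (M + 1))
    have h4 : 3 * M + 1 ∈ unseparated S ↔ (3 * M + 1 ∈ S ↔ 3 * M + 1 + 1 ∈ S) := by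
      simp only [unseparated, Set.mem_ofPred_eq]
      have : (3 * M + 1) % 3 = 1 := by omega
      simp [this]
    have h5 : excess S (3 * (M + 1)) = excess S (3 * M) + (if 3 * M + 1 ∈ S then 1 else -1) +
        (if 3 * M + 1 + 1 ∈ S then 1 else -1) + (if 3 * (M + 1) ∈ S then 1 else -1) := by
      unfold excess
      rw [show 3 * (M + 1) = 3 * M + 1 + 1 + 1 by ring, Finset.sum_range_succ,
        Finset.sum_range_succ, Finset.sum_range_succ]
    have h6 : excess S (M + 1) = excess S M + (if M + 1 ∈ S then 1 else -1) := by
      unfold excess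
      rw [Finset.sum_range_succ]
    rw [h5, h6]
    simp only [Set.mem_ofPred_eq] at h1
    rw [h1]
    simp only [h4] at h2
    rw [abs_le] at ih ⊢
    push_cast
    split_ifs at * <;> first | omega | (exfalso; tauto)

theorem abs_excess_sub_le (S : Set ℕ) (M j : ℕ) (hj : j ≤ 2) :
    |excess S (M + j) - excess S M| ≤ 2 := by
  unfold excess
  rw [Finset.sum_range_add, add_sub_cancel_left]
  refine (Finset.abs_sum_le_sum_abs _ _).trans ?_
  calc _ ≤ ∑ n ∈ Finset.range j, (1 : ℤ) := Finset.sum_le_sum fun n _ => by split_ifs <;> simp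
    _ = j := by simp
    _ ≤ 2 := by exact_mod_cast hj

/-- Induction from M = ⌊N/3⌋ to N. Of the available 3εM ≤ εN, one third is the induction hypothesis,
one third the exceptions (ε/2 + ε/2), and one third the at most two leftover terms. -/
theorem excess_le_of_separated {S : Set ℕ} (h3 : HasDensity {n | ¬ (n ∈ S ↔ 3 * n ∈ S)} 0)
    (hu : HasDensity (unseparated S) 0) {ε : ℝ} (hε : 0 < ε) :
    ∃ K : ℝ, ∀ N : ℕ, |(excess S N : ℝ)| ≤ ε * N + K := by
  have hu' : ∀ᶠ M : ℕ in atTop, (cnt (unseparated S) (3 * M) : ℝ) ≤ ε / 12 * (3 * M : ℕ) :=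
    (tendsto_id.const_mul_atTop' three_pos).eventually
      (hasDensity_zero_iff.1 hu (ε / 12) (by positivity))
  have hlarge : ∀ᶠ M : ℕ in atTop, 2 ≤ ε * (M : ℝ) :=
    (tendsto_natCast_atTop_atTop.const_mul_atTop hε).eventually_ge_atTop _
  obtain ⟨M₀, hM₀⟩ := eventually_atTop.1
    ((hasDensity_zero_iff.1 h3 (ε / 4) (by positivity)).and (hu'.and hlarge))
  refine ⟨3 * M₀ + 3, fun N => ?_⟩
  induction N using Nat.strong_induction_on with
  | _ N ih =>
    have hN0 : (0 : ℝ) ≤ N := Nat.cast_nonneg N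
    rcases lt_or_ge N (3 * M₀ + 3) with hN | hN
    · have h1 : |(excess S N : ℝ)| ≤ N := by exact_mod_cast abs_excess_le S N
      have h2 : (N : ℝ) ≤ 3 * M₀ + 3 := by exact_mod_cast hN.le
      have : 0 ≤ ε * N := by positivity
      linarith
    · obtain ⟨h1, h2, h3⟩ := hM₀ (N / 3) (by omega)
      have h4 := ih (N / 3) (by omega)
      have h5 := (Int.cast_le (R := ℝ)).2 (abs_excess_three_mul_sub_le S (N / 3))
      have h6 : |(excess S N : ℝ) - excess S (3 * (N / 3))| ≤ 2 := by
        have := abs_excess_sub_le S (3 * (N / 3)) (N % 3) (by omega)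
        rw [Nat.div_add_mod] at this
        exact_mod_cast this
      have h7 : (3 : ℝ) * (N / 3 : ℕ) ≤ N := by exact_mod_cast Nat.mul_div_le N 3
      have h8 : ε * ((3 : ℝ) * (N / 3 : ℕ)) ≤ ε * N := by gcongr
      push_cast at h5 h2
      rw [abs_le] at *
      constructor <;> linarith [h4.1, h4.2, h5.1, h5.2, h6.1, h6.2]

theorem hasDensity_half_of_separated {S : Set ℕ}
    (h3 : HasDensity {n | ¬ (n ∈ S ↔ 3 * n ∈ S)} 0) (hu : HasDensity (unseparated S) 0) :
    HasDensity S (1 / 2) := by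
  unfold HasDensity
  rw [Metric.tendsto_atTop']
  intro ε hε
  obtain ⟨K, hK⟩ := excess_le_of_separated h3 hu hε
  have hlarge : ∀ᶠ N : ℕ in atTop, K + 1 ≤ ε * (N : ℝ) :=
    (tendsto_natCast_atTop_atTop.const_mul_atTop hε).eventually_ge_atTop _
  obtain ⟨N₀, hN₀⟩ := eventually_atTop.1 hlarge
  refine ⟨N₀, fun N hN => ?_⟩
  have h0 : (0 : ℝ) < N := by exact_mod_cast (Nat.zero_le N₀).trans_lt hN
  have h1 : 2 * (cnt S N : ℝ) = N + excess S N := by exact_mod_cast two_mul_cnt_eq S N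
  have h2 : countRatio S N - 1 / 2 = (excess S N : ℝ) / (2 * N) := by
    change (cnt S N : ℝ) / N - 1 / 2 = _
    rw [show (cnt S N : ℝ) = (N + excess S N) / 2 by linarith]
    field_simp
    ring
  rw [Real.dist_eq, h2, abs_div, abs_of_pos (a := 2 * (N : ℝ)) (by positivity),
    div_lt_iff₀ (by positivity)]
  linarith [hK N, hN₀ N hN.le]

/-! ### Null modifications, triples and the conclusion. -/

theorem HasDensity.congr {S S' : Set ℕ} {δ : ℝ} (hS : HasDensity S δ)
    (h : HasDensity (symmDiff S S') 0) : HasDensity S' δ := by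
  have key (N : ℕ) : |countRatio S' N - countRatio S N| ≤ countRatio (symmDiff S S') N := by
    change |(cnt S' N : ℝ) / N - (cnt S N : ℝ) / N| ≤ (cnt (symmDiff S S') N : ℝ) / N
    rw [← sub_div, abs_div, Nat.abs_cast]
    gcongr
    have h1 : (cnt S' N : ℝ) ≤ cnt S N + cnt (symmDiff S S') N := by
      exact_mod_cast (cnt_le_of_imp (B := S ∪ symmDiff S S') fun n _ _ hn => by
        simp only [Set.mem_union, Set.mem_symmDiff]; tauto).trans (cnt_union_le _ _ _)
    have h2 : (cnt S N : ℝ) ≤ cnt S' N + cnt (symmDiff S S') N := by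
      exact_mod_cast (cnt_le_of_imp (B := S' ∪ symmDiff S S') fun n _ _ hn => by
        simp only [Set.mem_union, Set.mem_symmDiff]; tauto).trans (cnt_union_le _ _ _)
    rw [abs_le]
    constructor <;> linarith
  have h1 : Tendsto (fun N => countRatio S' N - countRatio S N) atTop (𝓝 0) :=
    squeeze_zero_norm key h
  have h2 := hS.add h1
  simp only [add_zero, add_sub_cancel] at h2
  exact h2

theorem IsStable.congr {S S' : Set ℕ} (hS : IsStable S) (h : HasDensity (symmDiff S S') 0) :
    IsStable S' := by
  intro p hp
  rw [hasDensity_zero_iff] at h ⊢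
  intro ε hε
  have hp0 : (0 : ℝ) < p := by exact_mod_cast hp.pos
  have h1 : ∀ᶠ N : ℕ in atTop,
      (cnt (symmDiff S S') (p * N) : ℝ) ≤ ε / (4 * p) * (p * N : ℕ) :=
    (tendsto_id.const_mul_atTop' hp.pos).eventually (h (ε / (4 * p)) (by positivity))
  filter_upwards [hasDensity_zero_iff.1 (hS p hp) (ε / 2) (by positivity), h1] with N h2 h1
  have h3 := (Nat.cast_le (α := ℝ)).2 (cnt_not_iff_mul_le S' S hp.ne_zero N)
  rw [symmDiff_comm] at h3
  push_cast at h3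
  have h4 : ε / (4 * p) * (p * N : ℕ) = ε / 4 * N := by
    push_cast
    field_simp
  linarith

theorem mem_shiftInter_three {S : Set ℕ} {n : ℕ} :
    n ∈ shiftInter S 3 ↔ ∃ m, n = m + 2 ∧ m ∈ S ∧ m + 1 ∈ S ∧ m + 2 ∈ S := by
  simp only [shiftInter, Set.mem_iInter, Set.mem_Iio, Set.mem_image]
  constructor
  · intro h
    obtain ⟨a, ha, ha'⟩ := h 0 (by omega)
    obtain ⟨b, hb, hb'⟩ := h 1 (by omega)
    obtain ⟨c, hc, hc'⟩ := h 2 (by omega)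
    obtain rfl : a = c + 2 := by omega
    obtain rfl : b = c + 1 := by omega
    exact ⟨c, by omega, hc, hb, ha⟩
  · rintro ⟨m, rfl, h0, h1, h2⟩ j hj
    interval_cases j
    · exact ⟨m + 2, h2, rfl⟩
    · exact ⟨m + 1, h1, rfl⟩
    · exact ⟨m, h0, rfl⟩

theorem hasDensity_shiftInter_three {S : Set ℕ} (h0 : 0 ∉ S) (hu : HasDensity (unseparated S) 0) :
    HasDensity (shiftInter S 3) 0 := by
  rw [hasDensity_zero_iff] at hu ⊢
  intro ε hε
  filter_upwards [hu (ε / 2) (by positivity)] with N hN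
  -- For a triple m, m+1, m+2 in S, the unseparated point is m+1 if 3 divides m, and m otherwise.
  -- The strict inequalities guard against truncated subtraction.
  have h1 : cnt (shiftInter S 3) N ≤ cnt ({n | n - 1 ∈ unseparated S ∧ 1 < n} ∪
      {n | n - 2 ∈ unseparated S ∧ 2 < n}) N := cnt_le_of_imp fun n _ _ hn => by
    obtain ⟨m, rfl, hm0, hm1, hm2⟩ := mem_shiftInter_three.1 hn
    have hm : m ≠ 0 := by rintro rfl; exact h0 hm0
    simp only [unseparated, Set.mem_union, Set.mem_ofPred_eq,
      show m + 2 - 1 = m + 1 by omega, Nat.add_sub_cancel, show m + 1 + 1 = m + 2 from rfl, hm0,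
      hm1, hm2, iff_self, and_true]
    omega
  have h2 (j : ℕ) : cnt {n | n - j ∈ unseparated S ∧ j < n} N ≤ cnt (unseparated S) N := by
    have h3 : {n | n - j ∈ unseparated S ∧ j < n} ∩ Set.Icc 1 N ⊆
        (· + j) '' (unseparated S ∩ Set.Icc 1 N) := by
      rintro n ⟨⟨h3, h4⟩, h5, h6⟩
      exact ⟨n - j, ⟨h3, by omega, by omega⟩, by simp only; omega⟩
    exact (Set.ncard_le_ncard h3 ((finite_inter_Icc _ _).image _)).trans
      (Set.ncard_image_le (finite_inter_Icc _ _))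
  have h3 : (cnt (shiftInter S 3) N : ℝ) ≤ 2 * cnt (unseparated S) N := by
    have := cnt_union_le {n | n - 1 ∈ unseparated S ∧ 1 < n} {n | n - 2 ∈ unseparated S ∧ 2 < n} N
    have := h2 1
    have := h2 2
    exact_mod_cast (by omega : cnt (shiftInter S 3) N ≤ 2 * cnt (unseparated S) N)
  linarith

theorem shiftInter_three_diff_self (S : Set ℕ) : shiftInter (S \ shiftInter S 3) 3 = ∅ := by
  refine Set.eq_empty_of_forall_notMem fun n hn => ?_
  obtain ⟨m, rfl, h0, h1, h2⟩ := mem_shiftInter_three.1 hn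
  exact h2.2 (mem_shiftInter_three.2 ⟨m, rfl, h0.1, h1.1, h2.1⟩)

/-- There is a stable set `S` of positive integers of density `1/2` such that
`S ∩ (S + 1) ∩ (S + 2)` has density `0`; after deleting this intersection from `S` one gets a
stable set of density `1/2` whose triple intersection is empty. In particular, the weak form of
Hildebrand's conjecture fails for `k = 3`. -/
theorem theorem1p3 :
    (∃ S : Set ℕ, 0 ∉ S ∧ IsStable S ∧ HasDensity S (1 / 2) ∧
      HasDensity (shiftInter S 3) 0 ∧
      IsStable (S \ shiftInter S 3) ∧ HasDensity (S \ shiftInter S 3) (1 / 2) ∧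
      shiftInter (S \ shiftInter S 3) 3 = ∅) ∧
    ¬ WeakHildebrandConjecture 3 := by
  obtain ⟨S, h0, hS, hu⟩ := exists_isStable_unseparated
  have hhalf := hasDensity_half_of_separated (hS 3 Nat.prime_three) hu
  have hI := hasDensity_shiftInter_three h0 hu
  have hdiff : HasDensity (symmDiff S (S \ shiftInter S 3)) 0 := by
    rw [hasDensity_zero_iff] at hI ⊢
    refine fun ε hε => (hI ε hε).subset (fun n hn => ?_) le_rfl
    simp only [Set.mem_symmDiff, Set.mem_sdiff] at hn
    tauto
  have hS' := hS.congr hdiff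
  have hhalf' := hhalf.congr hdiff
  refine ⟨⟨S, h0, hS, hhalf, hI, hS', hhalf', shiftInter_three_diff_self S⟩, fun hW => ?_⟩
  have hne := hW _ (fun h => h0 h.1) hS' (by
    rw [lowerDensity, hhalf'.liminf_eq]
    norm_num)
  rw [shiftInter_three_diff_self] at hne
  exact Set.not_nonempty_empty hne
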